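/- For a unit vector $\psi\in\mathbb C^2\otimes\mathbb C^2\otimes\mathbb C^2$ (a pure state of three qubits $A,B,C$) let $\rho_{AB}=\mathrm{Tr}_C|\psi\rangle\langle\psi|$, $\rho_{BC}=\mathrm{Tr}_A|\psi\rangle\langle\psi|$, $\rho_{AC}=\mathrm{Tr}_B|\psi\rangle\langle\psi|$ be its two-qubit reduced states. The concurrence of a bipartite pure state $\phi$ on $XY$ is $C(\phi)=\sqrt{2(1-\mathrm{Tr}\,\sigma_X^2)}$ with $\sigma_X=\mathrm{Tr}_Y|\phi\rangle\langle\phi|$, and the concurrence of a mixed state $\rho$ is $C(\rho)=\min\sum_i p_i\,C(\phi_i)$, the minimum being over all finite decompositions $\rho=\sum_i p_i|\phi_i\rangle\langle\phi_i|$ with $p_i\ge 0$, $\sum_i p_i=1$ and unit vectors $\phi_i$. Put $sC(\psi)=C(\rho_{AB})+C(\rho_{BC})+C(\rho_{AC})$ and $|W\rangle=\frac1{\sqrt3}(|001\rangle+|010\rangle+|100\rangle)$. Then the maximum of $sC(\psi)$ over all three-qubit pure states $\psi$ is $2$, and a three-qubit pure state $\psi$ satisfies $sC(\psi)=2$ if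 and only if $\psi=(U_1\otimes U_2\otimes U_3)|W\rangle$ for some $2\times 2$ unitary matrices $U_1,U_2,U_3$. -/

import Mathlib

open scoped Kronecker Matrix

noncomputable section

namespace QubitConcurrence

/-- The rank-one operator `|φ⟩⟨φ|`. -/
def ketbra {ι : Type*} (φ : EuclideanSpace ℂ ι) : Matrix ι ι ℂ :=
  Matrix.of fun i j => φ i * star (φ j)

/-- The partial trace over the second factor of a bipartite system. -/
def traceRight {α β : Type*} [Fintype β] (M : Matrix (α × β) (α × β) ℂ) : Matrix α α ℂ :=
  Matrix.of fun i j => ∑ k, M (i, k) (j, k)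

/-- The concurrence `√(2 (1 - Tr ρ_A²))` of a bipartite pure state `φ`, where
`ρ_A = Tr_B |φ⟩⟨φ|`. -/
def pureConcurrence {α β : Type*} [Fintype α] [Fintype β]
    (φ : EuclideanSpace ℂ (α × β)) : ℝ :=
  Real.sqrt (2 * (1 - (traceRight (ketbra φ) * traceRight (ketbra φ)).trace.re))

/-- The finite ensemble `{p i, φ i}` of pure states is a decomposition of the operator `ρ`. -/
structure IsDecomposition {ι : Type*} [Fintype ι] (ρ : Matrix ι ι ℂ) {n : ℕ}
    (p : Fin n → ℝ) (φ : Fin n → EuclideanSpace ℂ ι) : Prop where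
  nonneg : ∀ i, 0 ≤ p i
  sum_eq_one : ∑ i, p i = 1
  norm_eq_one : ∀ i, ‖φ i‖ = 1
  eq_sum : ρ = ∑ i, (p i : ℂ) • ketbra (φ i)

/-- The concurrence of a bipartite mixed state, by the convex roof construction: the infimum of
`∑ i, p i * C (φ i)` over all finite pure-state decompositions of `ρ`. -/
def concurrence {α β : Type*} [Fintype α] [Fintype β]
    (ρ : Matrix (α × β) (α × β) ℂ) : ℝ :=
  sInf {c : ℝ | ∃ (n : ℕ) (p : Fin n → ℝ) (φ : Fin n → EuclideanSpace ℂ (α × β)),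
    IsDecomposition ρ p φ ∧ c = ∑ i, p i * pureConcurrence (φ i)}

/-- The three-qubit space `ℂ² ⊗ ℂ² ⊗ ℂ²`, in the computational basis `|a b c⟩`. -/
abbrev ThreeQubit : Type := EuclideanSpace ℂ (Fin 2 × Fin 2 × Fin 2)

/-- `ρ_AB = Tr_C |ψ⟩⟨ψ|`. -/
def rhoAB (ψ : ThreeQubit) : Matrix (Fin 2 × Fin 2) (Fin 2 × Fin 2) ℂ :=
  Matrix.of fun x y => ∑ c, ketbra ψ (x.1, x.2, c) (y.1, y.2, c)

/-- `ρ_AC = Tr_B |ψ⟩⟨ψ|`. -/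
def rhoAC (ψ : ThreeQubit) : Matrix (Fin 2 × Fin 2) (Fin 2 × Fin 2) ℂ :=
  Matrix.of fun x y => ∑ b, ketbra ψ (x.1, b, x.2) (y.1, b, y.2)

/-- `ρ_BC = Tr_A |ψ⟩⟨ψ|`. -/
def rhoBC (ψ : ThreeQubit) : Matrix (Fin 2 × Fin 2) (Fin 2 × Fin 2) ℂ :=
  Matrix.of fun x y => ∑ a, ketbra ψ (a, x.1, x.2) (a, y.1, y.2)

/-- The sum `C_AB + C_BC + C_AC` of the pairwise concurrences. -/
def sC (ψ : ThreeQubit) : ℝ :=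
  concurrence (rhoAB ψ) + concurrence (rhoBC ψ) + concurrence (rhoAC ψ)

/-- The W state `(|001⟩ + |010⟩ + |100⟩) / √3`. -/
def stateW : ThreeQubit :=
  ((1 / Real.sqrt 3 : ℝ) : ℂ) •
    (EuclideanSpace.single (0, 0, 1) 1 + EuclideanSpace.single (0, 1, 0) 1
      + EuclideanSpace.single (1, 0, 0) 1)

/-- `φ = (U₁ ⊗ U₂ ⊗ U₃) ψ` for some unitaries `U₁, U₂, U₃` on the three qubits. -/
def LocalUnitaryEquiv (φ ψ : ThreeQubit) : Prop :=
  ∃ U₁ ∈ Matrix.unitaryGroup (Fin 2) ℂ, ∃ U₂ ∈ Matrix.unitaryGroup (Fin 2) ℂ,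
    ∃ U₃ ∈ Matrix.unitaryGroup (Fin 2) ℂ,
      φ = WithLp.toLp 2 ((U₁ ⊗ₖ (U₂ ⊗ₖ U₃)) *ᵥ WithLp.ofLp ψ)

end QubitConcurrence

end

open scoped Kronecker Matrix

namespace QubitConcurrence

/-! Local unitaries change neither side of the problem, so `exists_canonical_form` reduces to states
with no `|001⟩`, `|010⟩`, `|011⟩` component. Slicing such a state along the traced-out qubit gives
one explicit decomposition of each reduced state, hence an upper bound on the convex roof; no exact
mixed-state formula is needed. With `a, b, c, d, e` the moduli at `000, 110, 101, 100, 111`,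
`sC_le_of_canonical` yields `sC ≤ 2(ab + ac + bc + de)`, and normalization makes `2` minus this
bound a sum of squares. Equality forces `a = b = c` and `d = e = 0`, which is W up to a flip of the
first qubit and phases. That W attains `2` needs a lower bound over all decompositions:
`two_mul_norm_le_concurrence`. -/

/-- The action of an operator on a Hilbert space with a chosen orthonormal basis. -/
def act {ι : Type*} [Fintype ι] (W : Matrix ι ι ℂ) (φ : EuclideanSpace ℂ ι) :
    EuclideanSpace ℂ ι :=
  WithLp.toLp 2 (W *ᵥ WithLp.ofLp φ)

/-- The determinant of the `2 × 2` coefficient matrix of a two-qubit vector. -/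
def coeffDet (φ : EuclideanSpace ℂ (Fin 2 × Fin 2)) : ℂ :=
  φ (0, 0) * φ (1, 1) - φ (0, 1) * φ (1, 0)

/-! ### Unitary action on vectors and ensembles -/

section General

theorem ketbra_eq_vecMulVec {ι : Type*} (φ : EuclideanSpace ℂ ι) :
    ketbra φ = Matrix.vecMulVec (WithLp.ofLp φ) (star (WithLp.ofLp φ)) := by
  ext i j
  simp [ketbra, Matrix.vecMulVec_apply]

theorem ketbra_smul {ι : Type*} (r : ℝ) (φ : EuclideanSpace ℂ ι) :
    ketbra ((r : ℂ) • φ) = ((r ^ 2 : ℝ) : ℂ) • ketbra φ := by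
  ext i j
  simp only [ketbra, Matrix.of_apply, PiLp.smul_apply, smul_eq_mul, Matrix.smul_apply,
    star_mul', RCLike.star_def, Complex.conj_ofReal]
  push_cast
  ring

variable {ι : Type*} [Fintype ι]

theorem act_act (V W : Matrix ι ι ℂ) (φ : EuclideanSpace ℂ ι) :
    act V (act W φ) = act (V * W) φ := by
  simp [act, Matrix.mulVec_mulVec]

theorem ketbra_act (W : Matrix ι ι ℂ) (φ : EuclideanSpace ℂ ι) :
    ketbra (act W φ) = W * ketbra φ * Wᴴ := by
  rw [ketbra_eq_vecMulVec, ketbra_eq_vecMulVec, Matrix.mul_vecMulVec, Matrix.vecMulVec_mul]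
  simp [act, Matrix.star_mulVec]

variable [DecidableEq ι]

theorem act_one (φ : EuclideanSpace ℂ ι) : act 1 φ = φ := by
  simp [act]

theorem norm_act {W : Matrix ι ι ℂ} (hW : W ∈ Matrix.unitaryGroup ι ℂ)
    (φ : EuclideanSpace ℂ ι) : ‖act W φ‖ = ‖φ‖ := by
  have h : inner ℂ (act W φ) (act W φ) = inner ℂ φ φ := by
    simp only [EuclideanSpace.inner_eq_star_dotProduct, act]
    rw [dotProduct_comm, Matrix.star_mulVec, Matrix.dotProduct_mulVec, Matrix.vecMul_vecMul,
      ← Matrix.star_eq_conjTranspose, Matrix.mem_unitaryGroup_iff'.1 hW, Matrix.vecMul_one,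
      dotProduct_comm]
  rw [inner_self_eq_norm_sq_to_K, inner_self_eq_norm_sq_to_K] at h
  have h' : ‖act W φ‖ ^ 2 = ‖φ‖ ^ 2 := by exact_mod_cast h
  exact (pow_left_inj₀ (norm_nonneg _) (norm_nonneg _) two_ne_zero).1 h'

theorem IsDecomposition.conj {W : Matrix ι ι ℂ} (hW : W ∈ Matrix.unitaryGroup ι ℂ)
    {ρ : Matrix ι ι ℂ} {n : ℕ} {p : Fin n → ℝ} {φ : Fin n → EuclideanSpace ℂ ι}
    (h : IsDecomposition ρ p φ) :
    IsDecomposition (W * ρ * Wᴴ) p (fun i => act W (φ i)) where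
  nonneg := h.nonneg
  sum_eq_one := h.sum_eq_one
  norm_eq_one i := by rw [norm_act hW, h.norm_eq_one]
  eq_sum := by
    rw [h.eq_sum, Finset.mul_sum, Finset.sum_mul]
    simp [ketbra_act]

end General

/-! ### Two-qubit concurrence and its local invariance -/

theorem exists_norm_smul (v : EuclideanSpace ℂ (Fin 2 × Fin 2)) :
    ∃ φ : EuclideanSpace ℂ (Fin 2 × Fin 2), ‖φ‖ = 1 ∧ v = ((‖v‖ : ℝ) : ℂ) • φ := by
  by_cases hv : v = 0
  -- Any unit vector will do: it gets weight zero.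
  · exact ⟨EuclideanSpace.single (0, 0) 1, by simp, by simp [hv]⟩
  · have h : ((‖v‖ : ℝ) : ℂ) ≠ 0 := by simpa using hv
    refine ⟨((‖v‖ : ℝ) : ℂ)⁻¹ • v, ?_, ?_⟩
    · rw [norm_smul]
      simp [hv]
    · rw [smul_smul, mul_inv_cancel₀ h, one_smul]

/-- For a `2 × 2` matrix `Tr σ² = (Tr σ)² - 2 det σ`; here `Tr σ = 1` and `det σ` is the squared
modulus of the coefficient determinant. -/
theorem pureConcurrence_eq {φ : EuclideanSpace ℂ (Fin 2 × Fin 2)} (hφ : ‖φ‖ = 1) :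
    pureConcurrence φ = 2 * ‖coeffDet φ‖ := by
  have hn : ‖φ‖ ^ 2 = 1 := by rw [hφ]; norm_num
  rw [EuclideanSpace.norm_sq_eq] at hn
  simp only [Fintype.sum_prod_type, Fin.sum_univ_two, ← Complex.normSq_eq_norm_sq,
    Complex.normSq_apply] at hn
  have key : 2 * (1 - (traceRight (ketbra φ) * traceRight (ketbra φ)).trace.re)
      = (2 * ‖coeffDet φ‖) ^ 2 := by
    rw [mul_pow, ← Complex.normSq_eq_norm_sq, Complex.normSq_apply]
    simp only [coeffDet, traceRight, ketbra, Matrix.trace, Matrix.diag, Matrix.mul_apply,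
      Matrix.of_apply, Fin.sum_univ_two, Complex.add_re, Complex.mul_re, Complex.add_im,
      Complex.mul_im, Complex.sub_re, Complex.sub_im, RCLike.star_def, Complex.conj_re,
      Complex.conj_im]
    generalize (φ (0, 0)).re = a, (φ (0, 0)).im = a', (φ (0, 1)).re = b, (φ (0, 1)).im = b',
      (φ (1, 0)).re = c, (φ (1, 0)).im = c', (φ (1, 1)).re = d, (φ (1, 1)).im = d' at hn ⊢
    -- With `N = ‖φ‖²` the two sides differ by `2(1 - N²) = -2(N + 1)(N - 1)`.
    linear_combination (-2) * (a * a + a' * a' + (b * b + b' * b') +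
      (c * c + c' * c' + (d * d + d' * d')) + 1) * hn
  rw [pureConcurrence, key, Real.sqrt_sq (by positivity)]

theorem norm_det_eq_one {A : Matrix (Fin 2) (Fin 2) ℂ}
    (hA : A ∈ Matrix.unitaryGroup (Fin 2) ℂ) : ‖A.det‖ = 1 := by
  have h := congrArg norm (Unitary.mem_iff.1 (Matrix.det_of_mem_unitary hA)).2
  rw [norm_mul, norm_star, norm_one] at h
  nlinarith [norm_nonneg A.det]

theorem norm_coeffDet_act_kronecker {U V : Matrix (Fin 2) (Fin 2) ℂ}
    (hU : U ∈ Matrix.unitaryGroup (Fin 2) ℂ) (hV : V ∈ Matrix.unitaryGroup (Fin 2) ℂ)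
    (φ : EuclideanSpace ℂ (Fin 2 × Fin 2)) :
    ‖coeffDet (act (U ⊗ₖ V) φ)‖ = ‖coeffDet φ‖ := by
  have h : coeffDet (act (U ⊗ₖ V) φ) = U.det * V.det * coeffDet φ := by
    simp [coeffDet, act, Matrix.det_fin_two, Matrix.mulVec, dotProduct,
      Fintype.sum_prod_type, Fin.sum_univ_two, Matrix.kroneckerMap_apply]
    ring
  rw [h, norm_mul, norm_mul, norm_det_eq_one hU, norm_det_eq_one hV]
  simp

theorem concurrence_conj {U V : Matrix (Fin 2) (Fin 2) ℂ}
    (hU : U ∈ Matrix.unitaryGroup (Fin 2) ℂ) (hV : V ∈ Matrix.unitaryGroup (Fin 2) ℂ)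
    (ρ : Matrix (Fin 2 × Fin 2) (Fin 2 × Fin 2) ℂ) :
    concurrence ((U ⊗ₖ V) * ρ * (U ⊗ₖ V)ᴴ) = concurrence ρ := by
  have sub : ∀ {U V : Matrix (Fin 2) (Fin 2) ℂ},
      U ∈ Matrix.unitaryGroup (Fin 2) ℂ → V ∈ Matrix.unitaryGroup (Fin 2) ℂ →
      ∀ ρ : Matrix (Fin 2 × Fin 2) (Fin 2 × Fin 2) ℂ, ∀ c : ℝ,
      (∃ (n : ℕ) (p : Fin n → ℝ) (φ : Fin n → EuclideanSpace ℂ (Fin 2 × Fin 2)),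
        IsDecomposition ρ p φ ∧ c = ∑ i, p i * pureConcurrence (φ i)) →
      ∃ (n : ℕ) (p : Fin n → ℝ) (φ : Fin n → EuclideanSpace ℂ (Fin 2 × Fin 2)),
        IsDecomposition ((U ⊗ₖ V) * ρ * (U ⊗ₖ V)ᴴ) p φ ∧
          c = ∑ i, p i * pureConcurrence (φ i) := by
    rintro U V hU hV ρ c ⟨n, p, φ, h, rfl⟩
    have h' := h.conj (Matrix.kronecker_mem_unitary hU hV)
    refine ⟨n, p, _, h', Finset.sum_congr rfl fun i _ => ?_⟩
    rw [pureConcurrence_eq (h.norm_eq_one i), pureConcurrence_eq (h'.norm_eq_one i),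
      norm_coeffDet_act_kronecker hU hV]
  unfold concurrence
  congr 1
  ext c
  refine ⟨fun hc => ?_, fun hc => sub hU hV ρ c hc⟩
  -- The reverse inclusion is the same one applied to the inverse unitaries.
  have hc' := sub (Unitary.star_mem hU) (Unitary.star_mem hV) _ c hc
  have hW : (star U ⊗ₖ star V) = (U ⊗ₖ V)ᴴ := by
    rw [Matrix.conjTranspose_kronecker]; rfl
  have h1 : (U ⊗ₖ V)ᴴ * (U ⊗ₖ V) = 1 :=
    Matrix.mem_unitaryGroup_iff'.1 (Matrix.kronecker_mem_unitary hU hV)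
  have h2 : (U ⊗ₖ V)ᴴ * ((U ⊗ₖ V) * ρ * (U ⊗ₖ V)ᴴ) * (U ⊗ₖ V)ᴴᴴ = ρ := by
    rw [Matrix.conjTranspose_conjTranspose]
    calc _ = ((U ⊗ₖ V)ᴴ * (U ⊗ₖ V)) * ρ * ((U ⊗ₖ V)ᴴ * (U ⊗ₖ V)) := by
          simp only [Matrix.mul_assoc]
      _ = ρ := by simp [h1]
  rw [hW, h2] at hc'
  exact hc'

/-- A unitary on the traced-out qubit acts on the slice from the right and cancels in `M * Mᴴ`. -/
theorem mul_transpose_unitary_mul_conjTranspose {ι κ : Type*} [Fintype ι] [Fintype κ]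
    [DecidableEq κ] (W : Matrix ι ι ℂ) (M : Matrix ι κ ℂ) {U : Matrix κ κ ℂ}
    (hU : U ∈ Matrix.unitaryGroup κ ℂ) :
    (W * M * Uᵀ) * (W * M * Uᵀ)ᴴ = W * (M * Mᴴ) * Wᴴ := by
  have h : Uᵀ * (Uᵀ)ᴴ = 1 := by
    have := Matrix.mem_unitaryGroup_iff'.1 hU
    rw [Matrix.star_eq_conjTranspose] at this
    have hc : (Uᵀ)ᴴ = Uᴴᵀ := rfl
    rw [hc, ← Matrix.transpose_mul, this, Matrix.transpose_one]
  calc _ = W * M * (Uᵀ * (Uᵀ)ᴴ) * Mᴴ * Wᴴ := by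
        simp only [Matrix.conjTranspose_mul, Matrix.mul_assoc]
    _ = _ := by rw [h]; simp only [Matrix.mul_one, Matrix.mul_assoc]

/-! ### Reduced states as `M * Mᴴ` -/

/-- A three-qubit vector as an operator from `C` to `AB`. -/
def sliceAB (ψ : ThreeQubit) : Matrix (Fin 2 × Fin 2) (Fin 2) ℂ :=
  Matrix.of fun x c => ψ (x.1, x.2, c)

/-- A three-qubit vector as an operator from `B` to `AC`. -/
def sliceAC (ψ : ThreeQubit) : Matrix (Fin 2 × Fin 2) (Fin 2) ℂ :=
  Matrix.of fun x b => ψ (x.1, b, x.2)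

/-- A three-qubit vector as an operator from `A` to `BC`. -/
def sliceBC (ψ : ThreeQubit) : Matrix (Fin 2 × Fin 2) (Fin 2) ℂ :=
  Matrix.of fun x a => ψ (a, x.1, x.2)

theorem rhoAB_eq (ψ : ThreeQubit) : rhoAB ψ = sliceAB ψ * (sliceAB ψ)ᴴ := by
  ext x y
  simp [rhoAB, sliceAB, ketbra, Matrix.mul_apply]

theorem rhoAC_eq (ψ : ThreeQubit) : rhoAC ψ = sliceAC ψ * (sliceAC ψ)ᴴ := by
  ext x y
  simp [rhoAC, sliceAC, ketbra, Matrix.mul_apply]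

theorem rhoBC_eq (ψ : ThreeQubit) : rhoBC ψ = sliceBC ψ * (sliceBC ψ)ᴴ := by
  ext x y
  simp [rhoBC, sliceBC, ketbra, Matrix.mul_apply]

theorem act_kronecker_apply (U₁ U₂ U₃ : Matrix (Fin 2) (Fin 2) ℂ) (ψ : ThreeQubit)
    (a b c : Fin 2) :
    act (U₁ ⊗ₖ (U₂ ⊗ₖ U₃)) ψ (a, b, c) =
      ∑ i, ∑ j, ∑ k, U₁ a i * (U₂ b j * U₃ c k) * ψ (i, j, k) := by
  simp [act, Matrix.mulVec, dotProduct, Fintype.sum_prod_type, Matrix.kroneckerMap_apply]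

theorem sliceAB_act (U₁ U₂ U₃ : Matrix (Fin 2) (Fin 2) ℂ) (ψ : ThreeQubit) :
    sliceAB (act (U₁ ⊗ₖ (U₂ ⊗ₖ U₃)) ψ) = (U₁ ⊗ₖ U₂) * sliceAB ψ * U₃ᵀ := by
  ext x c
  simp only [sliceAB, Matrix.of_apply, act_kronecker_apply, Matrix.mul_apply,
    Fintype.sum_prod_type, Fin.sum_univ_two, Matrix.kroneckerMap_apply, Matrix.transpose_apply]
  ring

theorem sliceAC_act (U₁ U₂ U₃ : Matrix (Fin 2) (Fin 2) ℂ) (ψ : ThreeQubit) :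
    sliceAC (act (U₁ ⊗ₖ (U₂ ⊗ₖ U₃)) ψ) = (U₁ ⊗ₖ U₃) * sliceAC ψ * U₂ᵀ := by
  ext x c
  simp only [sliceAC, Matrix.of_apply, act_kronecker_apply, Matrix.mul_apply,
    Fintype.sum_prod_type, Fin.sum_univ_two, Matrix.kroneckerMap_apply, Matrix.transpose_apply]
  ring

theorem sliceBC_act (U₁ U₂ U₃ : Matrix (Fin 2) (Fin 2) ℂ) (ψ : ThreeQubit) :
    sliceBC (act (U₁ ⊗ₖ (U₂ ⊗ₖ U₃)) ψ) = (U₂ ⊗ₖ U₃) * sliceBC ψ * U₁ᵀ := by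
  ext x c
  simp only [sliceBC, Matrix.of_apply, act_kronecker_apply, Matrix.mul_apply,
    Fintype.sum_prod_type, Fin.sum_univ_two, Matrix.kroneckerMap_apply, Matrix.transpose_apply]
  ring

theorem sC_act {U₁ U₂ U₃ : Matrix (Fin 2) (Fin 2) ℂ}
    (h₁ : U₁ ∈ Matrix.unitaryGroup (Fin 2) ℂ) (h₂ : U₂ ∈ Matrix.unitaryGroup (Fin 2) ℂ)
    (h₃ : U₃ ∈ Matrix.unitaryGroup (Fin 2) ℂ) (ψ : ThreeQubit) :
    sC (act (U₁ ⊗ₖ (U₂ ⊗ₖ U₃)) ψ) = sC ψ := by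
  simp only [sC, rhoAB_eq, rhoAC_eq, rhoBC_eq, sliceAB_act, sliceAC_act, sliceBC_act]
  rw [mul_transpose_unitary_mul_conjTranspose _ _ h₁,
    mul_transpose_unitary_mul_conjTranspose _ _ h₂,
    mul_transpose_unitary_mul_conjTranspose _ _ h₃, concurrence_conj h₁ h₂,
    concurrence_conj h₂ h₃, concurrence_conj h₁ h₃]

/-! ### Upper and lower bounds on the convex roof -/

/-- The `k`-th column of a matrix as a vector. -/
def colVec (M : Matrix (Fin 2 × Fin 2) (Fin 2) ℂ) (k : Fin 2) :
    EuclideanSpace ℂ (Fin 2 × Fin 2) :=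
  WithLp.toLp 2 fun x => M x k

/-- The columns of `M` form an unnormalized ensemble for `M * Mᴴ`. Since `coeffDet` is homogeneous
of degree two, the squared norms serving as weights are absorbed exactly. -/
theorem exists_isDecomposition {M : Matrix (Fin 2 × Fin 2) (Fin 2) ℂ}
    (hM : ∑ k, ‖colVec M k‖ ^ 2 = 1) :
    ∃ (p : Fin 2 → ℝ) (φ : Fin 2 → EuclideanSpace ℂ (Fin 2 × Fin 2)),
      IsDecomposition (M * Mᴴ) p φ ∧
        ∑ k, p k * pureConcurrence (φ k) = ∑ k, 2 * ‖coeffDet (colVec M k)‖ := by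
  choose φ hφ hv using fun k => exists_norm_smul (colVec M k)
  refine ⟨fun k => ‖colVec M k‖ ^ 2, φ, ⟨fun k => by positivity, hM, hφ, ?_⟩, ?_⟩
  · have h : ∀ k, ((‖colVec M k‖ ^ 2 : ℝ) : ℂ) • ketbra (φ k) = ketbra (colVec M k) := fun k => by
      rw [← ketbra_smul, ← hv]
    simp_rw [h]
    ext x y
    simp [Matrix.mul_apply, ketbra, colVec]
  · refine Finset.sum_congr rfl fun k _ => ?_
    have h : coeffDet (colVec M k) = ((‖colVec M k‖ ^ 2 : ℝ) : ℂ) * coeffDet (φ k) := by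
      conv_lhs => rw [hv k]
      simp only [coeffDet, PiLp.smul_apply, smul_eq_mul]
      push_cast
      ring
    rw [pureConcurrence_eq (hφ k), h, norm_mul, Complex.norm_real, Real.norm_eq_abs,
      abs_of_nonneg (by positivity)]
    ring

theorem concurrence_mul_conjTranspose_le {M : Matrix (Fin 2 × Fin 2) (Fin 2) ℂ}
    (hM : ∑ k, ‖colVec M k‖ ^ 2 = 1) :
    concurrence (M * Mᴴ) ≤ ∑ k, 2 * ‖coeffDet (colVec M k)‖ := by
  obtain ⟨p, φ, h, hs⟩ := exists_isDecomposition hM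
  refine csInf_le ⟨0, ?_⟩ ⟨2, p, φ, h, hs.symm⟩
  rintro _ ⟨n, p, φ, h, rfl⟩
  exact Finset.sum_nonneg fun i _ => mul_nonneg (h.nonneg i) (Real.sqrt_nonneg _)

/-- If `⟨11|ρ|11⟩ = 0`, the concurrence is at least twice the coherence `|⟨01|ρ|10⟩|`. -/
theorem two_mul_norm_le_concurrence {M : Matrix (Fin 2 × Fin 2) (Fin 2) ℂ}
    (hM : ∑ k, ‖colVec M k‖ ^ 2 = 1) (h11 : (M * Mᴴ) (1, 1) (1, 1) = 0) :
    2 * ‖(M * Mᴴ) (0, 1) (1, 0)‖ ≤ concurrence (M * Mᴴ) := by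
  obtain ⟨p, φ, h, hs⟩ := exists_isDecomposition hM
  refine le_csInf ⟨_, 2, p, φ, h, rfl⟩ ?_
  clear hs h φ p
  rintro _ ⟨n, p, φ, h, rfl⟩
  have hent : ∀ x y, (M * Mᴴ) x y = ∑ i, (p i : ℂ) * (φ i x * star (φ i y)) := fun x y => by
    rw [h.eq_sum]
    simp [Matrix.sum_apply, ketbra]
  -- A vanishing diagonal entry is a sum of nonnegative terms, so every member of positive weight
  -- has no `|11⟩` component and its determinant is just `-φ₀₁φ₁₀`.
  have hz : ∀ i, p i * ‖φ i (1, 1)‖ ^ 2 = 0 := by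
    have hsum : ∑ i, p i * ‖φ i (1, 1)‖ ^ 2 = 0 := by
      rw [hent] at h11
      have : ((∑ i, p i * ‖φ i (1, 1)‖ ^ 2 : ℝ) : ℂ) = 0 := by
        rw [← h11]
        push_cast
        refine Finset.sum_congr rfl fun i _ => ?_
        rw [RCLike.star_def, Complex.mul_conj, Complex.normSq_eq_norm_sq]
        push_cast
        rfl
      exact_mod_cast this
    intro i
    exact (Finset.sum_eq_zero_iff_of_nonneg
      fun i _ => mul_nonneg (h.nonneg i) (sq_nonneg _)).1 hsum i (Finset.mem_univ i)
  rw [hent]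
  calc 2 * ‖∑ i, (p i : ℂ) * (φ i (0, 1) * star (φ i (1, 0)))‖
      ≤ 2 * ∑ i, ‖(p i : ℂ) * (φ i (0, 1) * star (φ i (1, 0)))‖ := by
        gcongr
        exact norm_sum_le _ _
    _ = ∑ i, p i * pureConcurrence (φ i) := by
        rw [Finset.mul_sum]
        refine Finset.sum_congr rfl fun i _ => ?_
        rw [pureConcurrence_eq (h.norm_eq_one i), norm_mul, Complex.norm_real, Real.norm_eq_abs,
          abs_of_nonneg (h.nonneg i), norm_mul, norm_star]
        rcases mul_eq_zero.1 (hz i) with h0 | h0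
        · simp [h0]
        · have h0' : φ i (1, 1) = 0 := by simpa using h0
          rw [coeffDet, h0', mul_zero, zero_sub, norm_neg, norm_mul]
          ring

/-! ### Canonical form under local unitaries -/

theorem exists_unitary_row {x y : ℂ} (h : x ≠ 0 ∨ y ≠ 0) :
    ∃ U ∈ Matrix.unitaryGroup (Fin 2) ℂ, ∃ c : ℂ,
      U 0 0 = c * x ∧ U 0 1 = c * y ∧ U 1 0 = -(c * star y) ∧ U 1 1 = c * star x := by
  have hpos : 0 < Complex.normSq x + Complex.normSq y := by
    rcases h with h | h
    · exact add_pos_of_pos_of_nonneg (Complex.normSq_pos.2 h) (Complex.normSq_nonneg _)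
    · exact add_pos_of_nonneg_of_pos (Complex.normSq_nonneg _) (Complex.normSq_pos.2 h)
  set s := Complex.normSq x + Complex.normSq y with hs
  set c : ℂ := (((Real.sqrt s)⁻¹ : ℝ) : ℂ) with hc
  have hcc : c * c * (x * (starRingEnd ℂ) x + y * (starRingEnd ℂ) y) = 1 := by
    rw [Complex.mul_conj, Complex.mul_conj, hc]
    norm_cast
    rw [← hs, ← mul_inv, Real.mul_self_sqrt hpos.le, inv_mul_cancel₀ hpos.ne']
  have hsc : (starRingEnd ℂ) c = c := by rw [hc, Complex.conj_ofReal]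
  clear_value c
  refine ⟨!![c * x, c * y; -(c * star y), c * star x], ?_, c, by simp, by simp, by simp,
    by simp⟩
  rw [Matrix.mem_unitaryGroup_iff]
  ext i j
  fin_cases i <;> fin_cases j <;> simp [Matrix.mul_apply, Matrix.star_apply, hsc]
  · linear_combination hcc
  · ring
  · ring
  · linear_combination hcc

theorem exists_unitary_annihilate (x y : ℂ) :
    ∃ U ∈ Matrix.unitaryGroup (Fin 2) ℂ, U 1 0 * x + U 1 1 * y = 0 := by
  by_cases h : x = 0 ∧ y = 0
  · exact ⟨1, one_mem _, by simp [h.1, h.2]⟩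
  · have h' : star x ≠ 0 ∨ star y ≠ 0 := by
      rw [star_ne_zero, star_ne_zero]
      tauto
    obtain ⟨U, hU, c, -, -, h10, h11⟩ := exists_unitary_row h'
    refine ⟨U, hU, ?_⟩
    rw [h10, h11, star_star, star_star]
    ring

theorem exists_unitary_annihilate_of_det_eq_zero {S : Matrix (Fin 2) (Fin 2) ℂ}
    (hS : S.det = 0) :
    ∃ U ∈ Matrix.unitaryGroup (Fin 2) ℂ, ∀ j, U 1 0 * S j 0 + U 1 1 * S j 1 = 0 := by
  rw [Matrix.det_fin_two] at hS
  by_cases h : S 0 0 = 0 ∧ S 0 1 = 0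
  · obtain ⟨U, hU, h1⟩ := exists_unitary_annihilate (S 1 0) (S 1 1)
    refine ⟨U, hU, fun j => ?_⟩
    fin_cases j
    · simp [h.1, h.2]
    · exact h1
  · obtain ⟨U, hU, h0⟩ := exists_unitary_annihilate (S 0 0) (S 0 1)
    refine ⟨U, hU, fun j => ?_⟩
    fin_cases j
    · exact h0
    · simp only [Fin.mk_one]
      rcases not_and_or.1 h with h | h
      · refine (mul_eq_zero.1 ?_).resolve_left h
        linear_combination S 1 0 * h0 + U 1 1 * hS
      · refine (mul_eq_zero.1 ?_).resolve_left h
        linear_combination S 1 1 * h0 - U 1 0 * hS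

/-- Every pencil of `2 × 2` matrices contains a singular member. -/
theorem exists_unitary_det_eq_zero (S T : Matrix (Fin 2) (Fin 2) ℂ) :
    ∃ U ∈ Matrix.unitaryGroup (Fin 2) ℂ, (U 0 0 • S + U 0 1 • T).det = 0 := by
  -- The determinant is a binary quadratic form in `(x, y)`: either `(0, 1)` is a zero, or setting
  -- `x = 1` leaves a genuine quadratic in `y`.
  obtain ⟨x, y, hxy, hdet⟩ : ∃ x y : ℂ, (x ≠ 0 ∨ y ≠ 0) ∧ (x • S + y • T).det = 0 := by
    by_cases hT : T.det = 0
    · exact ⟨0, 1, by simp, by simpa using hT⟩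
    · obtain ⟨s, hs⟩ := IsAlgClosed.exists_pow_nat_eq (discrim T.det
        (S 0 0 * T 1 1 + T 0 0 * S 1 1 - S 0 1 * T 1 0 - T 0 1 * S 1 0) S.det) two_pos
      obtain ⟨z, hz⟩ := exists_quadratic_eq_zero hT ⟨s, by rw [← hs, sq]⟩
      refine ⟨1, z, by simp, ?_⟩
      simp only [Matrix.det_fin_two, Matrix.add_apply, Matrix.smul_apply, smul_eq_mul] at hz ⊢
      linear_combination hz
  obtain ⟨U, hU, c, h0, h1, -, -⟩ := exists_unitary_row hxy
  refine ⟨U, hU, ?_⟩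
  simp only [Matrix.det_fin_two, Matrix.add_apply, Matrix.smul_apply, smul_eq_mul] at hdet ⊢
  rw [h0, h1]
  linear_combination c ^ 2 * hdet

/-- The Acín form of a three-qubit state, up to the phases of its coefficients. -/
theorem exists_canonical_form (ψ : ThreeQubit) :
    ∃ U₁ ∈ Matrix.unitaryGroup (Fin 2) ℂ, ∃ U₂ ∈ Matrix.unitaryGroup (Fin 2) ℂ,
      ∃ U₃ ∈ Matrix.unitaryGroup (Fin 2) ℂ,
        act (U₁ ⊗ₖ (U₂ ⊗ₖ U₃)) ψ (0, 0, 1) = 0 ∧ act (U₁ ⊗ₖ (U₂ ⊗ₖ U₃)) ψ (0, 1, 0) = 0 ∧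
          act (U₁ ⊗ₖ (U₂ ⊗ₖ U₃)) ψ (0, 1, 1) = 0 := by
  -- `U₁` makes the slice at first index `0` singular, `U₃` then clears its second column, and `U₂`
  -- the lower entry of the remaining column.
  obtain ⟨U₁, h₁, hS⟩ := exists_unitary_det_eq_zero
    (Matrix.of fun j k => ψ (0, j, k)) (Matrix.of fun j k => ψ (1, j, k))
  obtain ⟨U₃, h₃, hk⟩ := exists_unitary_annihilate_of_det_eq_zero hS
  simp only [Matrix.add_apply, Matrix.smul_apply, smul_eq_mul, Matrix.of_apply] at hk
  obtain ⟨U₂, h₂, hj⟩ := exists_unitary_annihilate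
    (∑ k, U₃ 0 k * (U₁ 0 0 * ψ (0, 0, k) + U₁ 0 1 * ψ (1, 0, k)))
    (∑ k, U₃ 0 k * (U₁ 0 0 * ψ (0, 1, k) + U₁ 0 1 * ψ (1, 1, k)))
  have hk0 := hk 0
  have hk1 := hk 1
  refine ⟨U₁, h₁, U₂, h₂, U₃, h₃, ?_, ?_, ?_⟩ <;>
    simp only [act_kronecker_apply, Fin.sum_univ_two] at hj ⊢
  · linear_combination U₂ 0 0 * hk0 + U₂ 0 1 * hk1
  · linear_combination hj
  · linear_combination U₂ 1 0 * hk0 + U₂ 1 1 * hk1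

/-! ### The upper bound -/

theorem sum_norm_sq_eq (ψ : ThreeQubit) :
    ‖ψ‖ ^ 2 = ‖ψ (0, 0, 0)‖ ^ 2 + ‖ψ (0, 0, 1)‖ ^ 2 + ‖ψ (0, 1, 0)‖ ^ 2 + ‖ψ (0, 1, 1)‖ ^ 2 +
      ‖ψ (1, 0, 0)‖ ^ 2 + ‖ψ (1, 0, 1)‖ ^ 2 + ‖ψ (1, 1, 0)‖ ^ 2 + ‖ψ (1, 1, 1)‖ ^ 2 := by
  simp only [EuclideanSpace.norm_sq_eq, Fintype.sum_prod_type, Fin.sum_univ_two]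
  ring

theorem sum_norm_colVec_sliceAB (ψ : ThreeQubit) :
    ∑ k, ‖colVec (sliceAB ψ) k‖ ^ 2 = ‖ψ‖ ^ 2 := by
  simp only [EuclideanSpace.norm_sq_eq, Fintype.sum_prod_type, Fin.sum_univ_two, colVec,
    sliceAB, Matrix.of_apply]
  ring

theorem sum_norm_colVec_sliceAC (ψ : ThreeQubit) :
    ∑ k, ‖colVec (sliceAC ψ) k‖ ^ 2 = ‖ψ‖ ^ 2 := by
  simp only [EuclideanSpace.norm_sq_eq, Fintype.sum_prod_type, Fin.sum_univ_two, colVec,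
    sliceAC, Matrix.of_apply]
  ring

theorem sum_norm_colVec_sliceBC (ψ : ThreeQubit) :
    ∑ k, ‖colVec (sliceBC ψ) k‖ ^ 2 = ‖ψ‖ ^ 2 := by
  simp only [EuclideanSpace.norm_sq_eq, Fintype.sum_prod_type, Fin.sum_univ_two, colVec,
    sliceBC, Matrix.of_apply]

theorem sC_le_of_canonical {φ : ThreeQubit} (hφ : ‖φ‖ = 1) (h001 : φ (0, 0, 1) = 0)
    (h010 : φ (0, 1, 0) = 0) (h011 : φ (0, 1, 1) = 0) :
    sC φ ≤ 2 * (‖φ (0, 0, 0)‖ * ‖φ (1, 1, 0)‖ + ‖φ (0, 0, 0)‖ * ‖φ (1, 0, 1)‖ +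
      ‖φ (1, 0, 1)‖ * ‖φ (1, 1, 0)‖ + ‖φ (1, 0, 0)‖ * ‖φ (1, 1, 1)‖) := by
  have hsq : ‖φ‖ ^ 2 = 1 := by rw [hφ]; norm_num
  have hAB := concurrence_mul_conjTranspose_le ((sum_norm_colVec_sliceAB φ).trans hsq)
  have hAC := concurrence_mul_conjTranspose_le ((sum_norm_colVec_sliceAC φ).trans hsq)
  have hBC := concurrence_mul_conjTranspose_le ((sum_norm_colVec_sliceBC φ).trans hsq)
  simp only [coeffDet, colVec, sliceAB, sliceAC, sliceBC, Matrix.of_apply, Fin.sum_univ_two,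
    h001, h010, h011, mul_zero, zero_mul, sub_zero, norm_mul, norm_zero, add_zero,
    zero_add] at hAB hAC hBC
  -- Only the slice of BC at first index `1` has a two-term determinant.
  have htri := norm_sub_le (φ (1, 0, 0) * φ (1, 1, 1)) (φ (1, 0, 1) * φ (1, 1, 0))
  rw [norm_mul, norm_mul] at htri
  rw [sC, rhoAB_eq, rhoAC_eq, rhoBC_eq]
  simp only [sliceAB, sliceAC, sliceBC]
  linarith

theorem norm_act_kronecker {U₁ U₂ U₃ : Matrix (Fin 2) (Fin 2) ℂ}
    (h₁ : U₁ ∈ Matrix.unitaryGroup (Fin 2) ℂ) (h₂ : U₂ ∈ Matrix.unitaryGroup (Fin 2) ℂ)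
    (h₃ : U₃ ∈ Matrix.unitaryGroup (Fin 2) ℂ) (ψ : ThreeQubit) :
    ‖act (U₁ ⊗ₖ (U₂ ⊗ₖ U₃)) ψ‖ = ‖ψ‖ :=
  norm_act (Matrix.kronecker_mem_unitary h₁ (Matrix.kronecker_mem_unitary h₂ h₃)) ψ

theorem sC_le_two {ψ : ThreeQubit} (hψ : ‖ψ‖ = 1) : sC ψ ≤ 2 := by
  obtain ⟨U₁, h₁, U₂, h₂, U₃, h₃, h001, h010, h011⟩ := exists_canonical_form ψ
  rw [← sC_act h₁ h₂ h₃]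
  rw [← norm_act_kronecker h₁ h₂ h₃] at hψ
  generalize act (U₁ ⊗ₖ (U₂ ⊗ₖ U₃)) ψ = φ at *
  have hle := sC_le_of_canonical hψ h001 h010 h011
  have hn := sum_norm_sq_eq φ
  rw [hψ, h001, h010, h011, norm_zero] at hn
  -- In the notation of the moduli, `2` minus the bound is `(a-b)² + (a-c)² + (b-c)² + (d-e)² + d² +
  -- e²`.
  nlinarith [sq_nonneg (‖φ (0, 0, 0)‖ - ‖φ (1, 1, 0)‖),
    sq_nonneg (‖φ (0, 0, 0)‖ - ‖φ (1, 0, 1)‖), sq_nonneg (‖φ (1, 0, 1)‖ - ‖φ (1, 1, 0)‖),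
    sq_nonneg (‖φ (1, 0, 0)‖ - ‖φ (1, 1, 1)‖), sq_nonneg ‖φ (1, 0, 0)‖,
    sq_nonneg ‖φ (1, 1, 1)‖]

/-! ### The value at W -/

theorem stateW_apply (a b c : Fin 2) :
    stateW (a, b, c) = ((1 / Real.sqrt 3 : ℝ) : ℂ) *
      if (a : ℕ) + b + c = 1 then 1 else 0 := by
  fin_cases a <;> fin_cases b <;> fin_cases c <;> simp [stateW]

theorem norm_stateW : ‖stateW‖ = 1 := by
  have h : ‖stateW‖ ^ 2 = 1 := by
    rw [sum_norm_sq_eq]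
    simp [stateW_apply]
    norm_num
  exact (pow_eq_one_iff_of_nonneg (norm_nonneg _) two_ne_zero).1 h

theorem two_le_sC_stateW : 2 ≤ sC stateW := by
  have hsq : ‖stateW‖ ^ 2 = 1 := by rw [norm_stateW]; norm_num
  have hc : ‖((1 / Real.sqrt 3 : ℝ) : ℂ) * (starRingEnd ℂ) ((1 / Real.sqrt 3 : ℝ) : ℂ)‖
      = 1 / 3 := by
    rw [Complex.mul_conj, Complex.normSq_ofReal, Complex.norm_real, Real.norm_eq_abs,
      abs_mul_self, div_mul_div_comm, Real.mul_self_sqrt (by norm_num), one_mul]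
  have hAB := two_mul_norm_le_concurrence ((sum_norm_colVec_sliceAB stateW).trans hsq)
    (by simp [Matrix.mul_apply, sliceAB, stateW_apply])
  have hAC := two_mul_norm_le_concurrence ((sum_norm_colVec_sliceAC stateW).trans hsq)
    (by simp [Matrix.mul_apply, sliceAC, stateW_apply])
  have hBC := two_mul_norm_le_concurrence ((sum_norm_colVec_sliceBC stateW).trans hsq)
    (by simp [Matrix.mul_apply, sliceBC, stateW_apply])
  have eAB : (sliceAB stateW * (sliceAB stateW)ᴴ) (0, 1) (1, 0) =
      ((1 / Real.sqrt 3 : ℝ) : ℂ) * (starRingEnd ℂ) ((1 / Real.sqrt 3 : ℝ) : ℂ) := by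
    simp [Matrix.mul_apply, sliceAB, stateW_apply]
  have eAC : (sliceAC stateW * (sliceAC stateW)ᴴ) (0, 1) (1, 0) =
      ((1 / Real.sqrt 3 : ℝ) : ℂ) * (starRingEnd ℂ) ((1 / Real.sqrt 3 : ℝ) : ℂ) := by
    simp [Matrix.mul_apply, sliceAC, stateW_apply]
  have eBC : (sliceBC stateW * (sliceBC stateW)ᴴ) (0, 1) (1, 0) =
      ((1 / Real.sqrt 3 : ℝ) : ℂ) * (starRingEnd ℂ) ((1 / Real.sqrt 3 : ℝ) : ℂ) := by
    simp [Matrix.mul_apply, sliceBC, stateW_apply]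
  rw [eAB, hc] at hAB
  rw [eAC, hc] at hAC
  rw [eBC, hc] at hBC
  rw [sC, rhoAB_eq, rhoAC_eq, rhoBC_eq]
  linarith

theorem sC_stateW : sC stateW = 2 :=
  le_antisymm (sC_le_two norm_stateW) two_le_sC_stateW

/-! ### The case of equality -/

theorem LocalUnitaryEquiv.of_act {U₁ U₂ U₃ : Matrix (Fin 2) (Fin 2) ℂ}
    (h₁ : U₁ ∈ Matrix.unitaryGroup (Fin 2) ℂ) (h₂ : U₂ ∈ Matrix.unitaryGroup (Fin 2) ℂ)
    (h₃ : U₃ ∈ Matrix.unitaryGroup (Fin 2) ℂ) {ψ χ : ThreeQubit}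
    (h : LocalUnitaryEquiv (act (U₁ ⊗ₖ (U₂ ⊗ₖ U₃)) ψ) χ) : LocalUnitaryEquiv ψ χ := by
  obtain ⟨V₁, k₁, V₂, k₂, V₃, k₃, hV⟩ := h
  refine ⟨star U₁ * V₁, mul_mem (Unitary.star_mem h₁) k₁, star U₂ * V₂,
    mul_mem (Unitary.star_mem h₂) k₂, star U₃ * V₃, mul_mem (Unitary.star_mem h₃) k₃, ?_⟩
  change act _ ψ = act (V₁ ⊗ₖ (V₂ ⊗ₖ V₃)) χ at hV
  change ψ = act _ χ
  rw [Matrix.mul_kronecker_mul, Matrix.mul_kronecker_mul, ← act_act, ← hV, act_act,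
    ← Matrix.mul_kronecker_mul, ← Matrix.mul_kronecker_mul, Matrix.mem_unitaryGroup_iff'.1 h₁,
    Matrix.mem_unitaryGroup_iff'.1 h₂, Matrix.mem_unitaryGroup_iff'.1 h₃,
    Matrix.one_kronecker_one, Matrix.one_kronecker_one, act_one]

theorem localUnitaryEquiv_stateW_of_canonical {φ : ThreeQubit} (h001 : φ (0, 0, 1) = 0)
    (h010 : φ (0, 1, 0) = 0) (h011 : φ (0, 1, 1) = 0) (h100 : φ (1, 0, 0) = 0)
    (h111 : φ (1, 1, 1) = 0) (h000 : ‖φ (0, 0, 0)‖ ^ 2 = 1 / 3)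
    (h101 : ‖φ (1, 0, 1)‖ ^ 2 = 1 / 3) (h110 : ‖φ (1, 1, 0)‖ ^ 2 = 1 / 3) :
    LocalUnitaryEquiv φ stateW := by
  set r : ℂ := ((Real.sqrt 3 : ℝ) : ℂ) with hr
  have hrr : r * r = 3 := by
    rw [hr]
    norm_cast
    exact Real.mul_self_sqrt (by norm_num)
  have hr0 : r ≠ 0 := fun h => by simp [h] at hrr
  have hrc : (starRingEnd ℂ) r = r := Complex.conj_ofReal _
  have hphase : ∀ z : ℂ, ‖z‖ ^ 2 = 1 / 3 → r * z * (r * (starRingEnd ℂ) z) = 1 := fun z hz => by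
    have : z * (starRingEnd ℂ) z = 1 / 3 := by
      rw [Complex.mul_conj, Complex.normSq_eq_norm_sq, hz]
      norm_num
    linear_combination r * r * this + hrr / 3
  -- The support `000, 101, 110` is that of W with the first qubit flipped. Each unitary carries the
  -- phase of one coefficient, `r = √3` making it unimodular.
  refine ⟨!![0, r * φ (0, 0, 0); 1, 0], ?_, !![1, 0; 0, r * φ (1, 1, 0)], ?_,
    !![1, 0; 0, r * φ (1, 0, 1)], ?_, ?_⟩
  · rw [Matrix.mem_unitaryGroup_iff]
    ext i j
    fin_cases i <;> fin_cases j <;>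
      simp [Matrix.mul_apply, Matrix.star_apply, hrc, hphase _ h000]
  · rw [Matrix.mem_unitaryGroup_iff]
    ext i j
    fin_cases i <;> fin_cases j <;>
      simp [Matrix.mul_apply, Matrix.star_apply, hrc, hphase _ h110]
  · rw [Matrix.mem_unitaryGroup_iff]
    ext i j
    fin_cases i <;> fin_cases j <;>
      simp [Matrix.mul_apply, Matrix.star_apply, hrc, hphase _ h101]
  · change φ = act _ stateW
    ext ⟨a, b, c⟩
    rw [act_kronecker_apply]
    fin_cases a <;> fin_cases b <;> fin_cases c <;>
      simp [Fin.sum_univ_two, stateW_apply, h001, h010, h011, h100, h111, ← hr] <;> field_simp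

theorem localUnitaryEquiv_stateW_of_sC_eq_two {ψ : ThreeQubit} (hψ : ‖ψ‖ = 1)
    (h2 : sC ψ = 2) : LocalUnitaryEquiv ψ stateW := by
  obtain ⟨U₁, h₁, U₂, h₂, U₃, h₃, h001, h010, h011⟩ := exists_canonical_form ψ
  refine LocalUnitaryEquiv.of_act h₁ h₂ h₃ ?_
  rw [← sC_act h₁ h₂ h₃] at h2
  rw [← norm_act_kronecker h₁ h₂ h₃] at hψ
  generalize act (U₁ ⊗ₖ (U₂ ⊗ₖ U₃)) ψ = φ at *
  have hle := sC_le_of_canonical hψ h001 h010 h011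
  have hn := sum_norm_sq_eq φ
  rw [hψ, h001, h010, h011, norm_zero] at hn
  rw [h2] at hle
  set a := ‖φ (0, 0, 0)‖ with ha
  set b := ‖φ (1, 1, 0)‖ with hb
  set c := ‖φ (1, 0, 1)‖ with hc
  set d := ‖φ (1, 0, 0)‖ with hd
  set e := ‖φ (1, 1, 1)‖ with he
  have hsum : (a - b) ^ 2 + (a - c) ^ 2 + (b - c) ^ 2 + (d - e) ^ 2 + d ^ 2 + e ^ 2 ≤ 0 := by
    nlinarith
  have s₁ := sq_nonneg (a - b)
  have s₂ := sq_nonneg (a - c)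
  have s₃ := sq_nonneg (b - c)
  have s₄ := sq_nonneg (d - e)
  have s₅ := sq_nonneg d
  have s₆ := sq_nonneg e
  have hab : a - b = 0 := (pow_eq_zero_iff two_ne_zero).1 (by linarith)
  have hac : a - c = 0 := (pow_eq_zero_iff two_ne_zero).1 (by linarith)
  have hd0 : d = 0 := (pow_eq_zero_iff two_ne_zero).1 (by linarith)
  have he0 : e = 0 := (pow_eq_zero_iff two_ne_zero).1 (by linarith)
  have hb' : b = a := by linarith
  have hc' : c = a := by linarith
  rw [hb', hc', hd0, he0] at hn
  have h3 : a ^ 2 = 1 / 3 := by linarith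
  exact localUnitaryEquiv_stateW_of_canonical h001 h010 h011 (norm_eq_zero.1 hd0)
    (norm_eq_zero.1 he0) h3 (by rw [← hc, hc', h3]) (by rw [← hb, hb', h3])

end QubitConcurrence

theorem lemma1 :
    IsGreatest (QubitConcurrence.sC '' {ψ : QubitConcurrence.ThreeQubit | ‖ψ‖ = 1}) 2 ∧
    ∀ ψ : QubitConcurrence.ThreeQubit, ‖ψ‖ = 1 →
      (QubitConcurrence.sC ψ = 2 ↔
        QubitConcurrence.LocalUnitaryEquiv ψ QubitConcurrence.stateW) := by
  refine ⟨⟨⟨_, QubitConcurrence.norm_stateW, QubitConcurrence.sC_stateW⟩, ?_⟩, fun ψ hψ =>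
    ⟨QubitConcurrence.localUnitaryEquiv_stateW_of_sC_eq_two hψ, ?_⟩⟩
  · rintro _ ⟨ψ, hψ, rfl⟩
    exact QubitConcurrence.sC_le_two hψ
  · rintro ⟨U₁, h₁, U₂, h₂, U₃, h₃, rfl⟩
    exact (QubitConcurrence.sC_act h₁ h₂ h₃ _).trans QubitConcurrence.sC_stateW
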